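/- Let $G$ be a connected complex reductive group with centre $Z_G$, and let $X$ be a compact connected Riemann surface with universal cover $p:Y\to X$, on which $\pi_1(X)$ acts by deck transformations. Fix generators $\alpha_1,\dots,\alpha_g,\beta_1,\dots,\beta_g$ of $\pi_1(X)$ giving the usual presentation $$\pi_1(X)=\Big\langle \alpha_1,\dots,\alpha_g,\beta_1,\dots,\beta_g \;\Big|\; \prod_{i=1}^g\alpha_i\beta_i\alpha_i^{-1}\beta_i^{-1}=1\Big\rangle .$$ A representation $\rho:\pi_1(X)\to G$ is called Schottky if $\rho(\alpha_i)\in Z_G$ for all $i$. A Schottky $G$-bundle is a holomorphic principal $G$-bundle $E\to X$ which is isomorphic to $E_\rho=(Y\times G)/\!\sim$, where $(y,a)\sim(\gamma\cdot y,\rho(\gamma)a)$ for all $\gamma\in\pi_1(X)$, for some Schottky representation $\rho$. Let $q:\widetilde G\to G$ be a universal cover of $G$, so that $\ker q\cong\pi_1(G)$ is a discrete central subgroup of $\widetilde G$. The topological type of a principal $G$-bundle $E$ over $X$ is the image $\delta(E)$ of its class under the coboundary map $\delta:H^1(X,\underline{G})\to H^2(X,\ker q)\cong H^2(X,\pi_1(G))\cong\pi_1(G)$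 of the exact sequence $1\to\ker q\to\underline{\widetilde G}\to\underline{G}\to1$ of sheaves of continuous functions on $X$. Theorem. Let $E$ be a Schottky $G$-bundle over $X$. Then $E$ has trivial topological type: $\delta(E)$ is the identity element (of $H^2(X,\ker q)$, equivalently of $\pi_1(G)$). Moreover $E$ is topologically trivial, that is, isomorphic to $X\times G$ as a topological principal $G$-bundle. -/

import Mathlib

open scoped Manifold ContDiff Topology

/-! ### Surface groups and Schottky representations -/

/-- The relator `∏ᵢ αᵢ βᵢ αᵢ⁻¹ βᵢ⁻¹` (in increasing order of `i`) in the free group on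
`α₁, …, α_g` (the letters `Sum.inl i`) and `β₁, …, β_g` (the letters `Sum.inr i`). -/
def surfaceRelator (g : ℕ) : FreeGroup (Fin g ⊕ Fin g) :=
  (List.ofFn fun i : Fin g =>
    FreeGroup.of (Sum.inl i) * FreeGroup.of (Sum.inr i) *
      (FreeGroup.of (Sum.inl i))⁻¹ * (FreeGroup.of (Sum.inr i))⁻¹).prod

/-- The group `⟨α₁, …, α_g, β₁, …, β_g ∣ ∏ᵢ αᵢ βᵢ αᵢ⁻¹ βᵢ⁻¹ = 1⟩`. An isomorphism from it to
`π₁(X)` is a choice of generators of `π₁(X)` giving the usual presentation. -/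
abbrev SurfaceGroup (g : ℕ) : Type :=
  PresentedGroup ({surfaceRelator g} : Set (FreeGroup (Fin g ⊕ Fin g)))

/-- The generator `αᵢ`. -/
def SurfaceGroup.alpha {g : ℕ} (i : Fin g) : SurfaceGroup g :=
  PresentedGroup.of (Sum.inl i)

/-- The generator `βᵢ`. -/
def SurfaceGroup.beta {g : ℕ} (i : Fin g) : SurfaceGroup g :=
  PresentedGroup.of (Sum.inr i)

/-- A representation `ρ : π₁ → G` is Schottky, with respect to the generators of `π₁` given by
`e`, when every `ρ(αᵢ)` lies in the centre of `G`. -/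
def IsSchottkyRep {g : ℕ} {Γ G : Type*} [Group Γ] [Group G] (e : SurfaceGroup g ≃* Γ)
    (ρ : Γ →* G) : Prop :=
  ∀ i : Fin g, ρ (e (SurfaceGroup.alpha i)) ∈ Subgroup.center G

/-! ### Connected complex reductive groups -/

/-- Zariski closed subsets of `GL_n(ℂ)`: common zero loci of polynomials in the entries. -/
def IsZariskiClosedGL {n : ℕ} (S : Set (GL (Fin n) ℂ)) : Prop :=
  ∃ P : Set (MvPolynomial (Fin n × Fin n) ℂ),
    S = {A : GL (Fin n) ℂ | ∀ f ∈ P, MvPolynomial.eval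
      (fun ij => (A : Matrix (Fin n) (Fin n) ℂ) ij.1 ij.2) f = 0}

/-- `ι` identifies the complex Lie group `G` (modelled on `V`) with a Zariski closed subgroup of
`GL_n(ℂ)`. (An injective holomorphic homomorphism from a connected complex Lie group onto a closed
subgroup of `GL_n(ℂ)` is an isomorphism of Lie groups onto its image.) -/
structure IsLinearAlgebraicRealization (V : Type*) [NormedAddCommGroup V] [NormedSpace ℂ V]
    {G : Type*} [Group G] [TopologicalSpace G] [ChartedSpace V G] {n : ℕ}
    (ι : G →* GL (Fin n) ℂ) : Prop where
  injective : Function.Injective ι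
  holomorphic : ∀ i j, ContMDiff 𝓘(ℂ, V) 𝓘(ℂ) ω
    (fun a : G => (ι a : Matrix (Fin n) (Fin n) ℂ) i j)
  closed_range : IsZariskiClosedGL (Set.range ι)

/-- `G` is a connected complex reductive group: a connected complex Lie group which is a linear
algebraic group with trivial unipotent radical, that is, whose only normal connected unipotent
Zariski closed subgroup is the trivial one. -/
def IsConnectedComplexReductive (V : Type*) [NormedAddCommGroup V] [NormedSpace ℂ V]
    (G : Type*) [Group G] [TopologicalSpace G] [ChartedSpace V G] : Prop :=
  ConnectedSpace G ∧ LieGroup 𝓘(ℂ, V) ω G ∧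
  ∃ (n : ℕ) (ι : G →* GL (Fin n) ℂ), IsLinearAlgebraicRealization V ι ∧
    ∀ U : Subgroup G, U.Normal → IsZariskiClosedGL (ι '' (U : Set G)) →
      IsConnected (U : Set G) →
      (∀ u ∈ U, IsNilpotent ((ι u : Matrix (Fin n) (Fin n) ℂ) - 1)) → U = ⊥

/-! ### Principal bundles

A principal `G`-bundle is given by its projection `π : E → X` and a right action of `G` on `E`,
written as an action of `Gᵐᵒᵖ`: the point `e · h` is `MulOpposite.op h • e`. -/

/-- `π : E → X` is a holomorphic principal `G`-bundle over the Riemann surface `X`: it has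
local trivializations that are biholomorphic and `G`-equivariant.
Here `G` and `E` are complex manifolds modelled on `V` and `W`. -/
structure IsHolomorphicPrincipalBundle (V W : Type*)
    [NormedAddCommGroup V] [NormedSpace ℂ V] [NormedAddCommGroup W] [NormedSpace ℂ W]
    {X G E : Type*} [TopologicalSpace X] [ChartedSpace ℂ X]
    [Group G] [TopologicalSpace G] [ChartedSpace V G]
    [TopologicalSpace E] [ChartedSpace W E] [MulAction Gᵐᵒᵖ E] (π : E → X) : Prop where
  proj_smul : ∀ (h : G) (e : E), π (MulOpposite.op h • e) = π e
  locally_trivial : ∀ x : X, ∃ t : Bundle.Trivialization G π, x ∈ t.baseSet ∧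
    ContMDiffOn 𝓘(ℂ, W) (𝓘(ℂ).prod 𝓘(ℂ, V)) ω t t.source ∧
    ContMDiffOn (𝓘(ℂ).prod 𝓘(ℂ, V)) 𝓘(ℂ, W) ω t.toOpenPartialHomeomorph.symm t.target ∧
    ∀ (h : G), ∀ e ∈ t.source, (t (MulOpposite.op h • e)).2 = (t e).2 * h

/-- `π : E → X` is topologically trivial: isomorphic to `X × G`, as a topological principal
bundle. -/
def IsTopologicallyTrivial (G : Type*) {X E : Type*} [Group G] [TopologicalSpace G]
    [TopologicalSpace X] [TopologicalSpace E] [MulAction Gᵐᵒᵖ E] (π : E → X) : Prop :=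
  ∃ Ψ : E ≃ₜ X × G, (∀ e, (Ψ e).1 = π e) ∧
    ∀ (h : G) (e : E), Ψ (MulOpposite.op h • e) = ((Ψ e).1, (Ψ e).2 * h)

/-! ### The bundle of a representation, Schottky bundles -/

/-- The relation `(y, a) ∼ (γ · y, ρ(γ) a)` on `Y × G`. -/
def flatBundleSetoid {Γ G : Type*} [Group Γ] [Group G] (ρ : Γ →* G) (Y : Type*)
    [MulAction Γ Y] : Setoid (Y × G) where
  r a b := ∃ γ : Γ, b = (γ • a.1, ρ γ * a.2)
  iseqv :=
    { refl := fun a => ⟨1, by simp⟩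
      symm := by
        rintro a b ⟨γ, rfl⟩
        exact ⟨γ⁻¹, by simp⟩
      trans := by
        rintro a b c ⟨γ, rfl⟩ ⟨δ, rfl⟩
        exact ⟨δ * γ, by simp [mul_smul, mul_assoc]⟩ }

/-- The space `E_ρ = (Y × G) / π₁`, with the quotient topology. It is a principal bundle
with projection `[y, a] ↦ p y` and right action `[y, a] · h = [y, a h]`. -/
abbrev FlatBundle {Γ G : Type*} [Group Γ] [Group G] (ρ : Γ →* G) (Y : Type*)
    [MulAction Γ Y] : Type _ :=
  Quotient (flatBundleSetoid ρ Y)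

/-- `p : Y → X` is a universal cover of the Riemann surface `X`, on which `Γ = π₁(X)` acts by
deck transformations (freely, and simply transitively on the fibres of `p`); the complex structure
of `Y` is the one for which `p` is locally biholomorphic. -/
structure IsUniversalCoverWithGroup (Γ : Type*) [Group Γ] {X Y : Type*}
    [TopologicalSpace X] [ChartedSpace ℂ X] [TopologicalSpace Y] [ChartedSpace ℂ Y]
    [MulAction Γ Y] (p : Y → X) : Prop where
  simplyConnected : SimplyConnectedSpace Y
  isQuotientCovering : IsQuotientCoveringMap p Γ
  locallyBiholomorphic : IsLocalDiffeomorph 𝓘(ℂ) 𝓘(ℂ) ω p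

/-- The holomorphic principal bundle `π : E → X` is isomorphic to `E_ρ`: there is a homeomorphism
`E_ρ ≃ E` over `X`, `G`-equivariant, and biholomorphic for the complex structure on `E_ρ` coming
from `Y × G` (the one for which the quotient map `Y × G → E_ρ` is locally biholomorphic). -/
def IsIsoFlatBundle (V W : Type*)
    [NormedAddCommGroup V] [NormedSpace ℂ V] [NormedAddCommGroup W] [NormedSpace ℂ W]
    {X Y G E Γ : Type*} [Group Γ] [TopologicalSpace Y] [ChartedSpace ℂ Y] [MulAction Γ Y]
    [Group G] [TopologicalSpace G] [ChartedSpace V G]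
    [TopologicalSpace E] [ChartedSpace W E] [MulAction Gᵐᵒᵖ E]
    (p : Y → X) (ρ : Γ →* G) (π : E → X) : Prop :=
  ∃ Φ : FlatBundle ρ Y ≃ₜ E,
    (∀ (y : Y) (a : G), π (Φ (Quotient.mk _ (y, a))) = p y) ∧
    (∀ (y : Y) (a h : G),
      Φ (Quotient.mk _ (y, a * h)) = MulOpposite.op h • Φ (Quotient.mk _ (y, a))) ∧
    IsLocalDiffeomorph (𝓘(ℂ).prod 𝓘(ℂ, V)) 𝓘(ℂ, W) ω
      (fun z : Y × G => Φ (Quotient.mk _ z))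

/-- `π : E → X` is a Schottky `G`-bundle: a holomorphic principal `G`-bundle isomorphic to `E_ρ`
for some Schottky representation `ρ` of `Γ = π₁(X)`. -/
def IsSchottkyBundle (V W : Type*)
    [NormedAddCommGroup V] [NormedSpace ℂ V] [NormedAddCommGroup W] [NormedSpace ℂ W]
    {X Y G E Γ : Type*} [TopologicalSpace X] [ChartedSpace ℂ X] [Group Γ]
    [TopologicalSpace Y] [ChartedSpace ℂ Y] [MulAction Γ Y]
    [Group G] [TopologicalSpace G] [ChartedSpace V G]
    [TopologicalSpace E] [ChartedSpace W E] [MulAction Gᵐᵒᵖ E]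
    {g : ℕ} (e : SurfaceGroup g ≃* Γ) (p : Y → X) (π : E → X) : Prop :=
  IsHolomorphicPrincipalBundle V W (G := G) π ∧
    ∃ ρ : Γ →* G, IsSchottkyRep e ρ ∧ IsIsoFlatBundle V W p ρ π

/-! ### Čech cohomology in degree two with constant coefficients

Covers of `X` are indexed by the points of `X`: a family `U` of open sets with `x ∈ U x` (every open
cover is refined by such a one). Cochains are total functions, of which only the
restriction to the multiple intersections of some such cover matters; passing to the quotient
below is then the direct limit over all covers, ordered by refinement. -/

/-- `f` is locally constant on the (open) set `S`. -/
def LocallyConstantOn {X A : Type*} [TopologicalSpace X] (f : X → A) (S : Set X) : Prop :=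
  ∀ x ∈ S, ∀ᶠ y in 𝓝 x, f y = f x

/-- An open cover indexed by the points. -/
structure IsPointedCover {X : Type*} [TopologicalSpace X] (U : X → Set X) : Prop where
  isOpen : ∀ i, IsOpen (U i)
  mem : ∀ i, i ∈ U i

theorem IsPointedCover.inter {X : Type*} [TopologicalSpace X] {U U' : X → Set X}
    (h : IsPointedCover U) (h' : IsPointedCover U') : IsPointedCover (fun i => U i ∩ U' i) :=
  ⟨fun i => (h.isOpen i).inter (h'.isOpen i), fun i => ⟨h.mem i, h'.mem i⟩⟩

/-- `c` is, on the cover `U`, a Čech 2-cocycle with values in the constant sheaf `A`. -/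
structure IsCechCocycleOn {X A : Type*} [TopologicalSpace X] [CommGroup A] (U : X → Set X)
    (c : X → X → X → X → A) : Prop where
  locallyConstant : ∀ i j k, LocallyConstantOn (c i j k) (U i ∩ U j ∩ U k)
  cocycle : ∀ i j k l, ∀ x ∈ U i ∩ U j ∩ U k ∩ U l,
    c j k l x * (c i k l x)⁻¹ * c i j l x * (c i j k x)⁻¹ = 1

/-- `c` is, on the cover `U`, the Čech coboundary of the 1-cochain `b`. -/
structure IsCechCoboundaryOn {X A : Type*} [TopologicalSpace X] [CommGroup A] (U : X → Set X)
    (b : X → X → X → A) (c : X → X → X → X → A) : Prop where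
  locallyConstant : ∀ i j, LocallyConstantOn (b i j) (U i ∩ U j)
  coboundary : ∀ i j k, ∀ x ∈ U i ∩ U j ∩ U k, c i j k x = b j k x * (b i k x)⁻¹ * b i j x

/-- The 2-cocycles, over all covers. -/
def cechZ2 (X A : Type*) [TopologicalSpace X] [CommGroup A] :
    Subgroup (X → X → X → X → A) where
  carrier := {c | ∃ U : X → Set X, IsPointedCover U ∧ IsCechCocycleOn U c}
  one_mem' := ⟨fun _ => Set.univ, ⟨fun _ => isOpen_univ, fun _ => trivial⟩,
    ⟨fun _ _ _ _ _ => Filter.Eventually.of_forall fun _ => rfl, by simp⟩⟩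
  mul_mem' := by
    rintro a b ⟨U, hU, ha⟩ ⟨U', hU', hb⟩
    refine ⟨_, hU.inter hU', ⟨?_, ?_⟩⟩
    · rintro i j k x ⟨⟨hi, hj⟩, hk⟩
      filter_upwards [ha.locallyConstant i j k x ⟨⟨hi.1, hj.1⟩, hk.1⟩,
        hb.locallyConstant i j k x ⟨⟨hi.2, hj.2⟩, hk.2⟩] with y h1 h2
      simp [h1, h2]
    · rintro i j k l x ⟨⟨⟨hi, hj⟩, hk⟩, hl⟩
      have h1 := ha.cocycle i j k l x ⟨⟨⟨hi.1, hj.1⟩, hk.1⟩, hl.1⟩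
      have h2 := hb.cocycle i j k l x ⟨⟨⟨hi.2, hj.2⟩, hk.2⟩, hl.2⟩
      calc _ = (a j k l x * (a i k l x)⁻¹ * a i j l x * (a i j k x)⁻¹) *
            (b j k l x * (b i k l x)⁻¹ * b i j l x * (b i j k x)⁻¹) := by
              simp only [Pi.mul_apply, mul_inv]; ac_rfl
        _ = 1 := by rw [h1, h2, one_mul]
  inv_mem' := by
    rintro a ⟨U, hU, ha⟩
    refine ⟨U, hU, ⟨?_, ?_⟩⟩
    · intro i j k x hx
      filter_upwards [ha.locallyConstant i j k x hx] with y h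
      simp [h]
    · intro i j k l x hx
      have h1 := ha.cocycle i j k l x hx
      calc _ = (a j k l x * (a i k l x)⁻¹ * a i j l x * (a i j k x)⁻¹)⁻¹ := by
              simp only [Pi.inv_apply, mul_inv, inv_inv]
        _ = 1 := by rw [h1, inv_one]

/-- The 2-coboundaries, over all covers. -/
def cechB2 (X A : Type*) [TopologicalSpace X] [CommGroup A] :
    Subgroup (X → X → X → X → A) where
  carrier := {c | ∃ U : X → Set X, IsPointedCover U ∧ ∃ b, IsCechCoboundaryOn U b c}
  one_mem' := ⟨fun _ => Set.univ, ⟨fun _ => isOpen_univ, fun _ => trivial⟩, fun _ _ _ => 1,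
    ⟨fun _ _ _ _ => Filter.Eventually.of_forall fun _ => rfl, by simp⟩⟩
  mul_mem' := by
    rintro c c' ⟨U, hU, b, hb⟩ ⟨U', hU', b', hb'⟩
    refine ⟨_, hU.inter hU', fun i j x => b i j x * b' i j x, ⟨?_, ?_⟩⟩
    · rintro i j x ⟨hi, hj⟩
      filter_upwards [hb.locallyConstant i j x ⟨hi.1, hj.1⟩,
        hb'.locallyConstant i j x ⟨hi.2, hj.2⟩] with y h1 h2
      simp [h1, h2]
    · rintro i j k x ⟨⟨hi, hj⟩, hk⟩
      have h1 := hb.coboundary i j k x ⟨⟨hi.1, hj.1⟩, hk.1⟩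
      have h2 := hb'.coboundary i j k x ⟨⟨hi.2, hj.2⟩, hk.2⟩
      simp only [Pi.mul_apply, h1, h2, mul_inv]; ac_rfl
  inv_mem' := by
    rintro c ⟨U, hU, b, hb⟩
    refine ⟨U, hU, fun i j x => (b i j x)⁻¹, ⟨?_, ?_⟩⟩
    · intro i j x hx
      filter_upwards [hb.locallyConstant i j x hx] with y h
      simp [h]
    · intro i j k x hx
      simp only [Pi.inv_apply, hb.coboundary i j k x hx, mul_inv]

/-- `H²(X, A)`: Čech cohomology of the constant sheaf `A`, written multiplicatively. -/
abbrev CechH2 (X A : Type*) [TopologicalSpace X] [CommGroup A] : Type _ :=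
  cechZ2 X A ⧸ (cechB2 X A).subgroupOf (cechZ2 X A)

/-! ### The topological type -/

/-- `q : G' → G` is a universal cover of the topological group `G`. -/
structure IsUniversalCoverHom {G' G : Type*} [Group G'] [TopologicalSpace G']
    [Group G] [TopologicalSpace G] (q : G' →* G) : Prop where
  simplyConnected : SimplyConnectedSpace G'
  isCovering : IsCoveringMap q

/-- The kernel of a universal cover is central. -/
theorem IsUniversalCoverHom.ker_le_center {G' G : Type*} [Group G'] [TopologicalSpace G']
    [IsTopologicalGroup G'] [Group G] [TopologicalSpace G] {q : G' →* G}
    (hq : IsUniversalCoverHom q) : q.ker ≤ Subgroup.center G' := by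
  intro z hz
  rw [Subgroup.mem_center_iff]
  intro h
  have := hq.simplyConnected
  have hd : DiscreteTopology (q ⁻¹' {1}) := (hq.isCovering 1).1
  have hz1 : q z = 1 := hz
  let f : G' → q ⁻¹' {1} := fun a => ⟨a * z * a⁻¹, by simp [hz1]⟩
  have hf : Continuous f := by
    refine Continuous.subtype_mk ?_ _
    fun_prop
  have hc : f h = f 1 := PreconnectedSpace.constant inferInstance hf
  have hc' : h * z * h⁻¹ = 1 * z * 1⁻¹ := congrArg Subtype.val hc
  rw [mul_inv_eq_iff_eq_mul] at hc'
  simpa using hc'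

/-- The discrete abelian group `ker q ≅ π₁(G)`, for a universal cover `q : G' → G`. -/
def CoverKernel {G' G : Type*} [Group G'] [TopologicalSpace G'] [Group G] [TopologicalSpace G]
    {q : G' →* G} (_hq : IsUniversalCoverHom q) : Type _ :=
  q.ker

/-- The inclusion of `ker q` in `G'`. -/
def CoverKernel.val {G' G : Type*} [Group G'] [TopologicalSpace G'] [Group G]
    [TopologicalSpace G] {q : G' →* G} {hq : IsUniversalCoverHom q} (a : CoverKernel hq) : G' :=
  Subtype.val (p := fun x => x ∈ q.ker) a

instance CoverKernel.commGroup {G' G : Type*} [Group G'] [TopologicalSpace G']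
    [IsTopologicalGroup G'] [Group G] [TopologicalSpace G] {q : G' →* G}
    (hq : IsUniversalCoverHom q) : CommGroup (CoverKernel hq) :=
  { (inferInstance : Group q.ker) with
    mul_comm := fun a b =>
      Subtype.ext ((Subgroup.mem_center_iff.mp (hq.ker_le_center b.2)) a.1) }

/-- `HasTopologicalType hq π d` says that `δ(E) = d`, where `δ : H¹(X, G) → H²(X, ker q)` is the
coboundary map of the central extension `1 → ker q → G' → G → 1` of sheaves of continuous
functions on `X`, applied to the class of the principal bundle `π : E → X`. Explicitly: over some
cover `U` the bundle has continuous sections `s i`, with transition functions `s j = s i · t i j`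
that have continuous lifts `t' i j` to `G'`, and `d` is the class of the 2-cocycle
`t' i j · t' j k · (t' i k)⁻¹`. -/
def HasTopologicalType {X E G' G : Type*} [TopologicalSpace X] [TopologicalSpace E]
    [Group G'] [TopologicalSpace G'] [IsTopologicalGroup G'] [Group G] [TopologicalSpace G]
    [MulAction Gᵐᵒᵖ E] {q : G' →* G} (hq : IsUniversalCoverHom q) (π : E → X)
    (d : CechH2 X (CoverKernel hq)) : Prop :=
  ∃ (U : X → Set X) (s : X → X → E) (t' : X → X → X → G') (c : cechZ2 X (CoverKernel hq)),
    IsPointedCover U ∧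
    (∀ i, ContinuousOn (s i) (U i)) ∧ (∀ i, ∀ x ∈ U i, π (s i x) = x) ∧
    (∀ i j, ContinuousOn (t' i j) (U i ∩ U j)) ∧
    (∀ i j, ∀ x ∈ U i ∩ U j, s j x = MulOpposite.op (q (t' i j x)) • s i x) ∧
    (∀ i j k, ∀ x ∈ U i ∩ U j ∩ U k,
      CoverKernel.val (c.1 i j k x) = t' i j x * t' j k x * (t' i k x)⁻¹) ∧
    d = QuotientGroup.mk c

/-!
A flat bundle `E_ρ = (Y × G) / Γ` is topologically trivial as soon as there is a continuous
`f : Y → G` with `f (γ • y) = ρ γ * f y`: the map `(y, a) ↦ (p y, (f y)⁻¹ * a)` then descends to an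
equivariant homeomorphism `E_ρ ≃ X × G` (`FlatBundle.exists_homeomorph_prod`).

Call such an `f` a `ρ`-equivariant map. Existence of equivariant maps is invariant under homotopies
of representations (`exists_equivariant_of_homotopy`), a homotopy being a homomorphism
`R : Γ →* C(ℝ, G)` with end points at `0` and `1`. This is the homotopy invariance of principal
bundles over a compact Hausdorff base: given a partition of unity `φ₁, …, φₙ` subordinate to evenly
covered open sets, the time is raised from `0` to `1` in the steps `φ₁ + ⋯ + φₖ`, and each step only
changes the map over a single evenly covered set.

A Schottky representation of a surface group is homotopic to the trivial one, because `G` is path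
connected and `αᵢ`, `βᵢ` enter the relator only through their commutator: keeping the images of the
`βᵢ` equal to `1`, move the images of the `αᵢ` from `1` to `ρ (αᵢ)`; then, as the `ρ (αᵢ)` are
central, the images of the `βᵢ` may be moved from `1` to `ρ (βᵢ)`. Hence `E` is topologically
trivial.

For the topological type, a global section `σ` of `E` allows one to write the sections `s i`
defining the type as `s i = σ · h i`. The maps `h i` lift, after a refinement of the cover, to maps
`h' i` into the covering group, and `h' i * t' i j * (h' j)⁻¹` is a `1`-cochain with values in the
kernel whose coboundary is the cocycle `t' i j * t' j k * (t' i k)⁻¹`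
(`HasTopologicalType.eq_one_of_isTopologicallyTrivial`). Conversely, the global section itself
computes the type to be `1`.
-/

/-! ### Representations of surface groups -/

/-- The representation of the surface group with `αᵢ ↦ a i` and `βᵢ ↦ b i`, where each `a i`
commutes with `b i`. -/
def SurfaceGroup.homOfCommute {g : ℕ} {M : Type*} [Group M] (a b : Fin g → M)
    (h : ∀ i, Commute (a i) (b i)) : SurfaceGroup g →* M :=
  PresentedGroup.toGroup (f := Sum.elim a b) (by
    rintro r rfl
    rw [surfaceRelator, map_list_prod, List.map_ofFn]
    refine List.prod_eq_one ?_
    intro x hx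
    obtain ⟨i, rfl⟩ := (List.mem_ofFn' _ _).1 hx
    simp [(h i).eq])

@[simp] theorem SurfaceGroup.homOfCommute_alpha {g : ℕ} {M : Type*} [Group M] (a b : Fin g → M)
    (h : ∀ i, Commute (a i) (b i)) (i : Fin g) :
    SurfaceGroup.homOfCommute a b h (SurfaceGroup.alpha i) = a i :=
  PresentedGroup.toGroup.of _

@[simp] theorem SurfaceGroup.homOfCommute_beta {g : ℕ} {M : Type*} [Group M] (a b : Fin g → M)
    (h : ∀ i, Commute (a i) (b i)) (i : Fin g) :
    SurfaceGroup.homOfCommute a b h (SurfaceGroup.beta i) = b i :=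
  PresentedGroup.toGroup.of _

theorem SurfaceGroup.hom_ext {g : ℕ} {M : Type*} [Group M] {φ ψ : SurfaceGroup g →* M}
    (ha : ∀ i, φ (SurfaceGroup.alpha i) = ψ (SurfaceGroup.alpha i))
    (hb : ∀ i, φ (SurfaceGroup.beta i) = ψ (SurfaceGroup.beta i)) : φ = ψ :=
  PresentedGroup.ext (by rintro (i | i); exacts [ha i, hb i])

/-- Evaluation of continuous maps into a topological group at a point, as a homomorphism. -/
def ContinuousMap.evalHom {T G : Type*} [TopologicalSpace T] [Group G] [TopologicalSpace G]
    [IsTopologicalGroup G] (t : T) : C(T, G) →* G where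
  toFun f := f t
  map_one' := rfl
  map_mul' _ _ := rfl

@[simp] theorem ContinuousMap.evalHom_apply {T G : Type*} [TopologicalSpace T] [Group G]
    [TopologicalSpace G] [IsTopologicalGroup G] (t : T) (f : C(T, G)) :
    ContinuousMap.evalHom t f = f t := rfl

theorem exists_continuousMap_real_joining {G : Type*} [TopologicalSpace G] [PathConnectedSpace G]
    (a b : G) : ∃ f : C(ℝ, G), f 0 = a ∧ f 1 = b :=
  ⟨⟨(PathConnectedSpace.somePath a b).extend, (PathConnectedSpace.somePath a b).continuous_extend⟩,
    by simp, by simp⟩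

/-! ### Equivariant maps and homotopies of representations -/

section Equivariant

variable {Γ X Y G : Type*} [Group Γ] [TopologicalSpace X] [TopologicalSpace Y] [MulAction Γ Y]
  [Group G] [TopologicalSpace G] [IsTopologicalGroup G]

/-- The inductive step of homotopy invariance. If `f` is equivariant for `R` at time `u`, and `v`
agrees with `u` outside a closed set contained in the evenly covered set `p '' S`, then `f` can be
changed over `p '' S` to a map that is equivariant for `R` at time `v`. -/
theorem exists_equivariant_of_evenlyCovered {p : Y → X} (hp : IsQuotientCoveringMap p Γ)
    (R : Γ →* C(ℝ, G)) {u v : X → ℝ} (hu : Continuous u) (hv : Continuous v)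
    {S : Set Y} (hS : IsOpen S) (hdisj : ∀ γ : Γ, ((γ • ·) '' S ∩ S).Nonempty → γ = 1)
    {K : Set X} (hK : IsClosed K) (hKS : K ⊆ p '' S) (huv : ∀ x ∉ K, u x = v x)
    {f : Y → G} (hf : Continuous f)
    (hfe : ∀ (γ : Γ) y, f (γ • y) = R γ (u (p y)) * f y) :
    ∃ f' : Y → G, Continuous f' ∧ ∀ (γ : Γ) y, f' (γ • y) = R γ (v (p y)) * f' y := by
  classical
  have := hp.toContinuousConstSMul
  have hpc : Continuous p := hp.toIsQuotientMap.continuous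
  have hpS (γ : Γ) (y : Y) : p (γ • y) = p y :=
    hp.apply_eq_iff_mem_orbit.2 (MulAction.mem_orbit y γ)
  have huniq (γ δ : Γ) (y : Y) (h1 : γ⁻¹ • y ∈ S) (h2 : δ⁻¹ • y ∈ S) : γ = δ := by
    have := hdisj (δ⁻¹ * γ) ⟨δ⁻¹ • y, ⟨γ⁻¹ • y, h1, by simp [smul_smul]⟩, h2⟩
    exact (inv_mul_eq_one.1 this).symm
  have hex (y : Y) (h : p y ∈ p '' S) : ∃ γ : Γ, γ⁻¹ • y ∈ S := by
    obtain ⟨z, hz, hzy⟩ := h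
    obtain ⟨γ, hγ⟩ := hp.apply_eq_iff_mem_orbit.1 hzy
    exact ⟨γ⁻¹, by rw [inv_inv]; exact (show γ • y = z from hγ) ▸ hz⟩
  -- On the sheet `γ • S`, the change of `f` is left translation by `R γ v * (R γ u)⁻¹`.
  let f' : Y → G := fun y =>
    if h : ∃ γ : Γ, γ⁻¹ • y ∈ S then
      R h.choose (v (p y)) * (R h.choose (u (p y)))⁻¹ * f y else f y
  have hf'1 (γ : Γ) (y : Y) (h : γ⁻¹ • y ∈ S) :
      f' y = R γ (v (p y)) * (R γ (u (p y)))⁻¹ * f y := by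
    have h' : ∃ γ : Γ, γ⁻¹ • y ∈ S := ⟨γ, h⟩
    have : f' y = R h'.choose (v (p y)) * (R h'.choose (u (p y)))⁻¹ * f y := dif_pos h'
    rw [this, huniq _ _ _ h'.choose_spec h]
  have hf'2 (y : Y) (h : p y ∉ K) : f' y = f y := by
    by_cases h' : ∃ γ : Γ, γ⁻¹ • y ∈ S
    · obtain ⟨γ, hγ⟩ := h'
      rw [hf'1 γ y hγ, huv _ h, mul_inv_cancel, one_mul]
    · exact dif_neg h'
  refine ⟨f', continuous_iff_continuousAt.2 fun y => ?_, fun δ y => ?_⟩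
  · by_cases hy : p y ∈ K
    · obtain ⟨γ, hγ⟩ := hex y (hKS hy)
      have hc : Continuous fun z => R γ (v (p z)) * (R γ (u (p z)))⁻¹ * f z := by fun_prop
      refine hc.continuousAt.congr ?_
      filter_upwards [(hS.preimage (continuous_const_smul γ⁻¹)).mem_nhds hγ] with z hz
      exact (hf'1 γ z hz).symm
    · refine hf.continuousAt.congr ?_
      filter_upwards [(hK.isOpen_compl.preimage hpc).mem_nhds hy] with z hz
      exact (hf'2 z hz).symm
  · by_cases hy : p y ∈ K
    · obtain ⟨γ, hγ⟩ := hex y (hKS hy)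
      have h2 : (δ * γ)⁻¹ • δ • y ∈ S := by simpa [smul_smul] using hγ
      rw [hf'1 γ y hγ, hf'1 (δ * γ) (δ • y) h2, hpS, hfe]
      simp only [map_mul, ContinuousMap.mul_apply]
      group
    · rw [hf'2 y hy, hf'2 (δ • y) (by rwa [hpS]), hfe, huv _ hy]

/-- Homotopy invariance: if `R` is a homotopy of representations and its initial
representation admits an equivariant map, then so does the final one. -/
theorem exists_equivariant_of_homotopy [CompactSpace X] [T2Space X] {p : Y → X}
    (hp : IsQuotientCoveringMap p Γ) (R : Γ →* C(ℝ, G))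
    (h : ∃ f : Y → G, Continuous f ∧ ∀ (γ : Γ) y, f (γ • y) = R γ 0 * f y) :
    ∃ f : Y → G, Continuous f ∧ ∀ (γ : Γ) y, f (γ • y) = R γ 1 * f y := by
  classical
  have := hp.toContinuousConstSMul
  have hpo : IsOpenMap p := hp.isCoveringMap.isOpenMap
  have hsheet (y : Y) : ∃ S : Set Y, IsOpen S ∧ y ∈ S ∧
      ∀ γ : Γ, ((γ • ·) '' S ∩ S).Nonempty → γ = 1 := by
    obtain ⟨U, hU, hd⟩ := hp.disjoint y
    obtain ⟨S, hSU, hS, hy⟩ := mem_nhds_iff.1 hU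
    exact ⟨S, hS, hy, fun γ hγ => hd γ (hγ.mono (by gcongr))⟩
  choose S hSo hSm hSd using hsheet
  obtain ⟨T, hT⟩ := isCompact_univ.elim_finite_subcover (fun y => p '' S y)
    (fun y => hpo _ (hSo y)) (fun x _ => by
      obtain ⟨y, rfl⟩ := hp.surjective x
      exact Set.mem_iUnion.2 ⟨y, y, hSm y, rfl⟩)
  obtain ⟨φ, hφ⟩ := PartitionOfUnity.exists_isSubordinate isClosed_univ
    (fun y : T => p '' S y) (fun y => hpo _ (hSo y)) (by
      intro x hx
      obtain ⟨y, hy, hxy⟩ := Set.mem_iUnion₂.1 (hT hx)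
      exact Set.mem_iUnion.2 ⟨⟨y, hy⟩, hxy⟩)
  have key : ∀ A : Finset T, ∃ f : Y → G, Continuous f ∧
      ∀ (γ : Γ) y, f (γ • y) = R γ (∑ i ∈ A, φ i (p y)) * f y := by
    intro A
    induction A using Finset.induction_on with
    | empty => simpa using h
    | insert i A hi ih =>
      obtain ⟨f, hf, hfe⟩ := ih
      refine exists_equivariant_of_evenlyCovered hp R
        (u := fun x => ∑ i ∈ A, φ i x) (v := fun x => ∑ i ∈ insert i A, φ i x)
        (by fun_prop) (by fun_prop) (hSo i) (hSd i) (isClosed_tsupport (φ i)) (hφ i)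
        (fun x hx => ?_) hf hfe
      simp [Finset.sum_insert hi, image_eq_zero_of_notMem_tsupport hx]
  obtain ⟨f, hf, hfe⟩ := key Finset.univ
  refine ⟨f, hf, fun γ y => ?_⟩
  have h1 := φ.sum_eq_one (Set.mem_univ (p y))
  rw [finsum_eq_sum_of_fintype] at h1
  rw [hfe, h1]

/-- A Schottky representation in a path connected group is joined to the trivial representation by
two homotopies, the first moving the images of the `αᵢ` and the second those of the `βᵢ`; hence it
admits an equivariant map. -/
theorem IsSchottkyRep.exists_equivariant [CompactSpace X] [T2Space X] [PathConnectedSpace G]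
    {p : Y → X} (hp : IsQuotientCoveringMap p Γ) {g : ℕ} {e : SurfaceGroup g ≃* Γ} {ρ : Γ →* G}
    (hρ : IsSchottkyRep e ρ) :
    ∃ f : Y → G, Continuous f ∧ ∀ (γ : Γ) y, f (γ • y) = ρ γ * f y := by
  choose a ha0 ha1 using fun i : Fin g =>
    exists_continuousMap_real_joining 1 (ρ (e (SurfaceGroup.alpha i)))
  choose b hb0 hb1 using fun i : Fin g =>
    exists_continuousMap_real_joining 1 (ρ (e (SurfaceGroup.beta i)))
  let A : SurfaceGroup g →* C(ℝ, G) :=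
    SurfaceGroup.homOfCommute a 1 fun i => Commute.one_right _
  let B : SurfaceGroup g →* C(ℝ, G) :=
    SurfaceGroup.homOfCommute
      (fun i => ContinuousMap.const ℝ (ρ (e (SurfaceGroup.alpha i)))) b fun i =>
        ContinuousMap.ext fun t => (Subgroup.mem_center_iff.1 (hρ i) (b i t)).symm
  have hA : (ContinuousMap.evalHom 0).comp A = 1 :=
    SurfaceGroup.hom_ext (by simp [A, ha0]) (by simp [A])
  have hBα (i : Fin g) : B (SurfaceGroup.alpha i) =
      ContinuousMap.const ℝ (ρ (e (SurfaceGroup.alpha i))) :=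
    SurfaceGroup.homOfCommute_alpha _ _ _ i
  have hBβ (i : Fin g) : B (SurfaceGroup.beta i) = b i :=
    SurfaceGroup.homOfCommute_beta _ _ _ i
  have hAB : (ContinuousMap.evalHom 1).comp A = (ContinuousMap.evalHom 0).comp B :=
    SurfaceGroup.hom_ext (by simp [A, hBα, ha1]) (by simp [A, hBβ, hb0])
  have hB : (ContinuousMap.evalHom 1).comp B = ρ.comp e.toMonoidHom :=
    SurfaceGroup.hom_ext (by simp [hBα]) (by simp [hBβ, hb1])
  have h1 := exists_equivariant_of_homotopy hp (A.comp e.symm.toMonoidHom)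
    ⟨fun _ => 1, continuous_const, fun γ y => by
      simpa using (DFunLike.congr_fun hA (e.symm γ)).symm⟩
  have h2 := exists_equivariant_of_homotopy hp (B.comp e.symm.toMonoidHom) (by
    obtain ⟨f, hf, hfe⟩ := h1
    refine ⟨f, hf, fun γ y => ?_⟩
    rw [hfe]
    exact congrArg (· * f y) (DFunLike.congr_fun hAB (e.symm γ)))
  obtain ⟨f, hf, hfe⟩ := h2
  refine ⟨f, hf, fun γ y => ?_⟩
  rw [hfe]
  have h3 := DFunLike.congr_fun hB (e.symm γ)
  exact congrArg (· * f y) (by simpa using h3)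

/-! ### Trivialization of flat bundles -/

theorem FlatBundle.exists_homeomorph_prod {p : Y → X} (hp : IsQuotientCoveringMap p Γ)
    {ρ : Γ →* G} {f : Y → G} (hf : Continuous f) (hfe : ∀ (γ : Γ) y, f (γ • y) = ρ γ * f y) :
    ∃ Θ : FlatBundle ρ Y ≃ₜ X × G,
      ∀ y a, Θ (Quotient.mk _ (y, a)) = (p y, (f y)⁻¹ * a) := by
  have := hp.toContinuousConstSMul
  have hpo : IsOpenMap p := hp.isCoveringMap.isOpenMap
  have hpc : Continuous p := hp.toIsQuotientMap.continuous
  let shear : Y × G ≃ₜ Y × G :=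
    { toFun := fun z => (z.1, (f z.1)⁻¹ * z.2)
      invFun := fun z => (z.1, f z.1 * z.2)
      left_inv := fun z => by simp
      right_inv := fun z => by simp
      continuous_toFun := by fun_prop
      continuous_invFun := by fun_prop }
  let F : Y × G → X × G := Prod.map p id ∘ shear
  have hF : Continuous F := (hpc.prodMap continuous_id).comp shear.continuous
  have hFo : IsOpenMap F := (hpo.prodMap IsOpenMap.id).comp shear.isOpenMap
  have hFr : ∀ z w : Y × G, flatBundleSetoid ρ Y z w → F z = F w := by
    rintro ⟨y, a⟩ _ ⟨γ, rfl⟩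
    refine Prod.ext (hp.apply_eq_iff_mem_orbit.2 (MulAction.mem_orbit y γ)).symm ?_
    change (f y)⁻¹ * a = (f (γ • y))⁻¹ * (ρ γ * a)
    rw [hfe]
    group
  have hbij : Function.Bijective (Quotient.lift F hFr) := by
    refine ⟨?_, ?_⟩
    · rintro ⟨y, a⟩ ⟨z, b⟩ h
      have h1 : p z = p y := (congrArg Prod.fst h).symm
      have h2 : (f y)⁻¹ * a = (f z)⁻¹ * b := congrArg Prod.snd h
      obtain ⟨γ, rfl⟩ := hp.apply_eq_iff_mem_orbit.1 h1
      refine Quotient.sound ⟨γ, Prod.ext rfl ?_⟩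
      change b = ρ γ * a
      simp only [hfe] at h2
      rw [mul_inv_rev, mul_assoc] at h2
      rw [mul_left_cancel h2, mul_inv_cancel_left]
    · rintro ⟨x, a⟩
      obtain ⟨y, rfl⟩ := hp.surjective x
      exact ⟨Quotient.mk _ (y, f y * a), Prod.ext rfl (inv_mul_cancel_left _ _)⟩
  have hopen : IsOpenMap (Quotient.lift F hFr) := by
    intro O hO
    have : Quotient.lift F hFr '' O = F '' (Quotient.mk _ ⁻¹' O) := by
      conv_lhs => rw [← Set.image_preimage_eq O Quotient.mk_surjective]
      rw [← Set.image_comp]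
      rfl
    rw [this]
    exact hFo _ (hO.preimage continuous_quotient_mk')
  exact ⟨Equiv.toHomeomorphOfContinuousOpen (Equiv.ofBijective _ hbij)
    (hF.quotient_lift hFr) hopen, fun y a => rfl⟩

end Equivariant

/-! ### Topological type of a bundle with a global section -/

section TopologicalType

variable {X E G' G : Type*} [TopologicalSpace X] [TopologicalSpace E]
  [Group G'] [TopologicalSpace G'] [Group G] [TopologicalSpace G] [MulAction Gᵐᵒᵖ E]

theorem IsUniversalCoverHom.surjective [IsTopologicalGroup G] [ConnectedSpace G] {q : G' →* G}
    (hq : IsUniversalCoverHom q) : Function.Surjective q := by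
  have ho : IsOpen (q.range : Set G) := by
    rw [MonoidHom.coe_range]
    exact hq.isCovering.isOpenMap.isOpen_range
  have hu : (q.range : Set G) = Set.univ :=
    IsClopen.eq_univ ⟨Subgroup.isClosed_of_isOpen _ ho, ho⟩ ⟨1, q.range.one_mem⟩
  exact MonoidHom.range_eq_top.1 (SetLike.coe_injective hu)

/-- A continuous map into `G` lifts to the universal cover near any given point. -/
theorem IsUniversalCoverHom.exists_local_lift [IsTopologicalGroup G] [ConnectedSpace G]
    {q : G' →* G} (hq : IsUniversalCoverHom q) {h : X → G} {U : Set X} (hU : IsOpen U)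
    (hh : ContinuousOn h U) {x : X} (hx : x ∈ U) :
    ∃ (N : Set X) (h' : X → G'), IsOpen N ∧ x ∈ N ∧ N ⊆ U ∧ ContinuousOn h' N ∧
      ∀ y ∈ N, q (h' y) = h y := by
  obtain ⟨a, ha⟩ := hq.surjective (h x)
  obtain ⟨φ, haφ, hφ⟩ := hq.isCovering.isLocalHomeomorph a
  have hφx : h x ∈ φ.target := by
    rw [← ha, hφ]
    exact φ.map_source haφ
  refine ⟨U ∩ h ⁻¹' φ.target, φ.symm ∘ h, hh.isOpen_inter_preimage hU φ.open_target, ⟨hx, hφx⟩,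
    Set.inter_subset_left,
    φ.continuousOn_symm.comp (hh.mono Set.inter_subset_left) (fun y hy => hy.2), fun y hy => ?_⟩
  rw [hφ]
  exact φ.right_inv hy.2

/-- A continuous function on an open set that takes its values in a discrete fibre of a covering is
locally constant. -/
theorem IsUniversalCoverHom.locallyConstantOn_ker {q : G' →* G}
    (hq : IsUniversalCoverHom q) {b : X → CoverKernel hq} {O : Set X} (hO : IsOpen O)
    (hb : ContinuousOn (fun x => (b x).val) O) : LocallyConstantOn b O := by
  intro x hx
  -- Near `(b x).val` the map `q` is injective, while it is `1` at all the values of `b`.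
  obtain ⟨φ, hxφ, hφ⟩ := hq.isCovering.isLocalHomeomorph (b x).val
  have hc : ContinuousAt (fun x => (b x).val) x := hb.continuousAt (hO.mem_nhds hx)
  filter_upwards [hc (φ.open_source.mem_nhds hxφ)] with y hy
  refine Subtype.ext (φ.injOn hy hxφ ?_)
  rw [← hφ]
  exact (show q (b y).val = 1 from (b y).2).trans (show q (b x).val = 1 from (b x).2).symm

variable [IsTopologicalGroup G']

theorem CoverKernel.val_mul {q : G' →* G} {hq : IsUniversalCoverHom q} (a b : CoverKernel hq) :
    (a * b).val = a.val * b.val := rfl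

theorem CoverKernel.val_inv {q : G' →* G} {hq : IsUniversalCoverHom q} (a : CoverKernel hq) :
    (a⁻¹).val = a.val⁻¹ := rfl

theorem CoverKernel.val_one {q : G' →* G} {hq : IsUniversalCoverHom q} :
    (1 : CoverKernel hq).val = 1 := rfl

/-- For a topologically trivial bundle, every choice of local sections and of lifts of the
transition functions gives a coboundary. -/
theorem HasTopologicalType.eq_one_of_isTopologicallyTrivial [IsTopologicalGroup G]
    [ConnectedSpace G] {q : G' →* G} {hq : IsUniversalCoverHom q} {π : E → X}
    (hπ : IsTopologicallyTrivial G π) {d : CechH2 X (CoverKernel hq)}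
    (hd : HasTopologicalType hq π d) : d = 1 := by
  classical
  obtain ⟨Ψ, hΨ1, hΨ2⟩ := hπ
  obtain ⟨U, s, t', c, hU, hs, hsπ, ht, hst, hc, rfl⟩ := hd
  -- `h i` expresses the section `s i` in the trivialization.
  let h : X → X → G := fun i x => (Ψ (s i x)).2
  have hh (i : X) : ContinuousOn (h i) (U i) :=
    (continuous_snd.comp Ψ.continuous).comp_continuousOn (hs i)
  have hht (i j x : X) (hx : x ∈ U i ∩ U j) : h j x = h i x * q (t' i j x) := by
    simp only [h, hst i j x hx, hΨ2]
  choose N h' hNo hNm hNU hh'c hh'q using fun i =>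
    hq.exists_local_lift (hU.isOpen i) (hh i) (hU.mem i)
  have hker (i j x : X) (hx : x ∈ N i ∩ N j) : h' i x * t' i j x * (h' j x)⁻¹ ∈ q.ker := by
    rw [MonoidHom.mem_ker, map_mul, map_mul, map_inv, hh'q i x hx.1, hh'q j x hx.2,
      hht i j x ⟨hNU i hx.1, hNU j hx.2⟩, mul_inv_cancel]
  let b : X → X → X → CoverKernel hq := fun i j x =>
    if hx : x ∈ N i ∩ N j then ⟨h' i x * t' i j x * (h' j x)⁻¹, hker i j x hx⟩ else 1
  have hb (i j x : X) (hx : x ∈ N i ∩ N j) :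
      (b i j x).val = h' i x * t' i j x * (h' j x)⁻¹ :=
    congrArg CoverKernel.val (dif_pos hx)
  rw [QuotientGroup.eq_one_iff, Subgroup.mem_subgroupOf]
  refine ⟨N, ⟨hNo, hNm⟩, b, ⟨fun i j => ?_, fun i j k x hx => ?_⟩⟩
  · refine hq.locallyConstantOn_ker ((hNo i).inter (hNo j)) (ContinuousOn.congr ?_ (hb i j))
    exact (((hh'c i).mono Set.inter_subset_left).mul
      ((ht i j).mono (Set.inter_subset_inter (hNU i) (hNU j)))).mul
      ((hh'c j).mono Set.inter_subset_right).inv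
  · obtain ⟨⟨hi, hj⟩, hk⟩ := hx
    have hcen : h' i x * (c.1 i j k x).val = (c.1 i j k x).val * h' i x :=
      Subgroup.mem_center_iff.1 (hq.ker_le_center (c.1 i j k x).2) (h' i x)
    refine Subtype.ext ?_
    change (c.1 i j k x).val = (b j k x * (b i k x)⁻¹ * b i j x).val
    rw [mul_comm, ← mul_assoc, CoverKernel.val_mul, CoverKernel.val_mul, CoverKernel.val_inv,
      hb i j x ⟨hi, hj⟩, hb j k x ⟨hj, hk⟩, hb i k x ⟨hi, hk⟩, eq_comm]
    calc _ = h' i x * (t' i j x * t' j k x * (t' i k x)⁻¹) * (h' i x)⁻¹ := by group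
      _ = (c.1 i j k x).val := by
        rw [← hc i j k x ⟨⟨hNU i hi, hNU j hj⟩, hNU k hk⟩, hcen, mul_inv_cancel_right]

theorem IsTopologicallyTrivial.hasTopologicalType_one {q : G' →* G} (hq : IsUniversalCoverHom q)
    {π : E → X} (hπ : IsTopologicallyTrivial G π) :
    HasTopologicalType hq π (1 : CechH2 X (CoverKernel hq)) := by
  obtain ⟨Ψ, hΨ1, -⟩ := hπ
  refine ⟨fun _ => Set.univ, fun _ x => Ψ.symm (x, 1), fun _ _ _ => 1, 1,
    ⟨fun _ => isOpen_univ, fun _ => trivial⟩, fun _ => ?_, fun _ x _ => ?_,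
    fun _ _ => continuousOn_const, fun _ _ x _ => by simp, fun _ _ _ x _ => ?_, rfl⟩
  · exact (Ψ.symm.continuous.comp (by fun_prop : Continuous fun x : X => (x, (1 : G)))).continuousOn
  · simp [← hΨ1]
  · simpa using CoverKernel.val_one (hq := hq)

end TopologicalType

/-! ### Schottky bundles -/

theorem IsConnectedComplexReductive.pathConnectedSpace {V : Type*} [NormedAddCommGroup V]
    [NormedSpace ℂ V] {G : Type*} [Group G] [TopologicalSpace G] [ChartedSpace V G]
    (hG : IsConnectedComplexReductive V G) : PathConnectedSpace G := by
  have := hG.1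
  have : LocallyPathConnectedSpace V := by
    have : NormedSpace ℝ V := NormedSpace.restrictScalars ℝ ℂ V
    infer_instance
  have : LocallyPathConnectedSpace G := ChartedSpace.locallyPathConnectedSpace V G
  exact pathConnectedSpace_iff_connectedSpace.2 inferInstance

theorem mainTheorem2
    {X : Type*} [TopologicalSpace X] [CompactSpace X] [ConnectedSpace X] [T2Space X]
    [ChartedSpace ℂ X] [IsManifold 𝓘(ℂ) ω X] (x₀ : X)
    {g : ℕ} (e : SurfaceGroup g ≃* FundamentalGroup X x₀)
    {Y : Type*} [TopologicalSpace Y] [ChartedSpace ℂ Y] [IsManifold 𝓘(ℂ) ω Y]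
    [MulAction (FundamentalGroup X x₀) Y] (p : Y → X)
    (hp : IsUniversalCoverWithGroup (FundamentalGroup X x₀) p)
    {V : Type*} [NormedAddCommGroup V] [NormedSpace ℂ V] [FiniteDimensional ℂ V]
    {G : Type*} [Group G] [TopologicalSpace G] [ChartedSpace V G]
    (hG : IsConnectedComplexReductive V G)
    {W : Type*} [NormedAddCommGroup W] [NormedSpace ℂ W]
    {E : Type*} [TopologicalSpace E] [ChartedSpace W E] [IsManifold 𝓘(ℂ, W) ω E]
    [MulAction Gᵐᵒᵖ E] (π : E → X)
    (hE : IsSchottkyBundle V W (G := G) e p π) :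
    (∀ {G' : Type*} [Group G'] [TopologicalSpace G'] [IsTopologicalGroup G'] (q : G' →* G)
      (hq : IsUniversalCoverHom q) (d : CechH2 X (CoverKernel hq)),
      HasTopologicalType hq π d ↔ d = 1) ∧
    IsTopologicallyTrivial G π := by
  have : ConnectedSpace G := hG.1
  have : LieGroup 𝓘(ℂ, V) ω G := hG.2.1
  have : IsTopologicalGroup G := topologicalGroup_of_lieGroup 𝓘(ℂ, V) ω
  have : PathConnectedSpace G := hG.pathConnectedSpace
  obtain ⟨-, ρ, hρ, Φ, hΦp, hΦe, -⟩ := hE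
  obtain ⟨f, hf, hfe⟩ := hρ.exists_equivariant hp.isQuotientCovering
  obtain ⟨Θ, hΘ⟩ := FlatBundle.exists_homeomorph_prod hp.isQuotientCovering hf hfe
  have htriv : IsTopologicallyTrivial G π := by
    refine ⟨Φ.symm.trans Θ, fun z => ?_, fun h z => ?_⟩
    · obtain ⟨⟨y, a⟩, rfl⟩ := Φ.surjective z
      change (Θ (Φ.symm (Φ (Quotient.mk _ (y, a))))).1 = π (Φ (Quotient.mk _ (y, a)))
      rw [Φ.symm_apply_apply, hΘ, hΦp]
    · obtain ⟨⟨y, a⟩, rfl⟩ := Φ.surjective z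
      change Θ (Φ.symm (MulOpposite.op h • Φ (Quotient.mk _ (y, a)))) =
        ((Θ (Φ.symm (Φ (Quotient.mk _ (y, a))))).1, (Θ (Φ.symm (Φ (Quotient.mk _ (y, a))))).2 * h)
      rw [← hΦe, Φ.symm_apply_apply, Φ.symm_apply_apply, hΘ, hΘ, mul_assoc]
  refine ⟨fun q hq d => ⟨fun hd => hd.eq_one_of_isTopologicallyTrivial htriv, ?_⟩, htriv⟩
  rintro rfl
  exact htriv.hasTopologicalType_one hq
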